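/- Let $A\in\mathbb{R}^{n\times n}$ be skew-symmetric, let $C_i\in\mathbb{R}^{m_i\times n}$, $i=1,\dots,N$, and let $C=\mathrm{col}(C_1,\dots,C_N)$. Assume that $(C,A)$ is observable, i.e. that $\mathrm{col}(C,CA,\dots,CA^{n-1})$ has rank $n$. For each $i$ let $\mathcal{O}_i=\mathrm{col}(C_i,C_iA,\dots,C_iA^{n-1})$, let $\nu_i=\dim\ker\mathcal{O}_i$, and let $U_i\in\mathbb{R}^{n\times\nu_i}$ be a matrix whose columns form an orthonormal basis of $\ker\mathcal{O}_i$. Put $A_{i\bar{\mathrm{o}}}=U_i^TAU_i$, $\nu=\sum_i\nu_i$, $$U=\mathrm{block\,diag}\{U_1,\dots,U_N\}\in\mathbb{R}^{Nn\times\nu},\quad A_{\bar{\mathrm{o}}}=\mathrm{block\,diag}\{A_{1\bar{\mathrm{o}}},\dots,A_{N\bar{\mathrm{o}}}\},\quad \Gamma=\mathrm{block\,diag}\{\gamma_1I_{\nu_1},\dots,\gamma_NI_{\nu_N}\},$$ where $\gamma_i>0$ for all $i$. Let $\mathcal{G}_1,\dots,\mathcal{G}_{n_0}$ be undirected graphs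 without self-loops on the node set $\{1,\dots,N\}$, each with a symmetric nonnegative weighted adjacency matrix $[a_{ij}]$ such that $a_{ii}=0$ and, for $i\neq j$, $a_{ij}>0$ if and only if $(j,i)$ is an edge, and with Laplacian $\mathcal{L}_p=[l_{ij}]$, $l_{ii}=\sum_j a_{ij}$, $l_{ij}=-a_{ij}$ for $i\ne j$. Let $\sigma:[0,\infty)\to\{1,\dots,n_0\}$ be a piecewise constant switching signal: there are $\tau>0$ and switching instants $t_0=0$, $t_{j+1}-t_j\ge\tau$, such that $\sigma$ is constant on each $[t_j,t_{j+1})$. Assume that $\mathcal{G}_{\sigma(t)}$ is jointly connected: there are a subsequence $\{t_{j_k}\}_{k\ge0}$ of the switching instants with $t_{j_0}=0$ and a $T_{\mathrm{c}}>0$ such that, for all $k\ge0$, $\tau\le t_{j_{k+1}}-t_{j_k}\le T_{\mathrm{c}}$ and the union graph $\bigcup_{t_j\in[t_{j_k},t_{j_{k+1}})}\mathcal{G}_{\sigma(t_j)}$ is connected. Then the linear switched system $$\dot\zeta(t)=\left(A_{\bar{\mathrm{o}}}-\Gamma U^T(\mathcal{L}_{\sigma(t)}\otimes I_n)U\right)\zeta(t),\qquad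 t\ge0,$$ with state $\zeta(t)\in\mathbb{R}^{\nu}$, is exponentially stable: there are constants $\kappa,\lambda>0$ such that, for every initial time $t^*\ge0$, every solution on $[t^*,\infty)$ satisfies $\|\zeta(t)\|\le\kappa e^{-\lambda(t-t^*)}\|\zeta(t^*)\|$ for all $t\ge t^*$. -/

import Mathlib

open Matrix
open scoped Kronecker

/-! ### Observability -/

/-- The observability matrix `col(C, CA, …, CA^{n-1})` of a pair `(C, A)`; its rows are indexed
by pairs (power of `A`, row of `C`). -/
def obsMatrix {n : ℕ} {p : Type*} (C : Matrix p (Fin n) ℝ) (A : Matrix (Fin n) (Fin n) ℝ) :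
    Matrix (Fin n × p) (Fin n) ℝ :=
  Matrix.of fun kr j => (C * A ^ (kr.1 : ℕ)) kr.2 j

/-- `(C, A)` is observable: the observability matrix has full column rank `n`. -/
def IsObservable {n : ℕ} {p : Type*} (C : Matrix p (Fin n) ℝ) (A : Matrix (Fin n) (Fin n) ℝ) :
    Prop :=
  (obsMatrix C A).rank = n

/-- The stacked output matrix `C = col(C₁, …, C_N)`. -/
def stackedOutput {N n : ℕ} {m : Fin N → ℕ} (C : ∀ i, Matrix (Fin (m i)) (Fin n) ℝ) :
    Matrix ((i : Fin N) × Fin (m i)) (Fin n) ℝ :=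
  Matrix.of fun r j => C r.1 r.2 j

/-- The columns of `U` form an orthonormal basis of the unobservable subspace
`ker(col(C, CA, …, CA^{n-1}))` of `(C, A)`. In particular the number `d` of columns is the
dimension of that subspace. -/
structure IsUnobservableBasis {n d : ℕ} {p : Type*} (C : Matrix p (Fin n) ℝ)
    (A : Matrix (Fin n) (Fin n) ℝ) (U : Matrix (Fin n) (Fin d) ℝ) : Prop where
  orthonormal : Uᵀ * U = 1
  range_eq : LinearMap.range U.mulVecLin = LinearMap.ker (obsMatrix C A).mulVecLin

/-! ### Graphs and switching -/

/-- An undirected graph on `V` without self-loops, with a weighted adjacency matrix `[a_ij]`: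
symmetric, nonnegative, zero on the diagonal, and `a_ij > 0` exactly on the edges. -/
structure WeightedGraph (V : Type*) where
  graph : SimpleGraph V
  weight : Matrix V V ℝ
  weight_symm : ∀ i j, weight i j = weight j i
  weight_nonneg : ∀ i j, 0 ≤ weight i j
  weight_diag : ∀ i, weight i i = 0
  weight_pos_iff : ∀ i j, i ≠ j → (0 < weight i j ↔ graph.Adj j i)

/-- The Laplacian: `l_ii = ∑ j, a_ij` and `l_ij = -a_ij` for `i ≠ j`. -/
def WeightedGraph.laplacian {V : Type*} [Fintype V] [DecidableEq V] (G : WeightedGraph V) :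
    Matrix V V ℝ :=
  Matrix.of fun i j => if i = j then ∑ k, G.weight i k else -G.weight i j

/-- `σ` (of which only the values on `[0, ∞)` matter) is a piecewise constant switching signal
with switching instants `t 0 = 0 < t 1 < …` and dwell time `τ`. -/
structure IsSwitchingSignal {P : Type*} (σ : ℝ → P) (t : ℕ → ℝ) (τ : ℝ) : Prop where
  dwell_pos : 0 < τ
  start : t 0 = 0
  dwell : ∀ j, τ ≤ t (j + 1) - t j
  const : ∀ j, ∃ p, ∀ s ∈ Set.Ico (t j) (t (j + 1)), σ s = p

/-- Joint connectivity: there is a subsequence `t (j k)` of the switching instants, starting at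
`0`, with `τ ≤ t (j (k+1)) - t (j k) ≤ Tc` for some `Tc > 0`, such that for every `k` the union of
the graphs active at the switching instants in `[t (j k), t (j (k+1)))` is connected. -/
def JointlyConnected {V P : Type*} (G : P → WeightedGraph V) (σ : ℝ → P) (t : ℕ → ℝ) (τ : ℝ) :
    Prop :=
  ∃ (j : ℕ → ℕ) (Tc : ℝ), StrictMono j ∧ t (j 0) = 0 ∧ 0 < Tc ∧
    ∀ k, τ ≤ t (j (k + 1)) - t (j k) ∧ t (j (k + 1)) - t (j k) ≤ Tc ∧
      (⨆ (r : ℕ) (_ : t r ∈ Set.Ico (t (j k)) (t (j (k + 1)))), (G (σ (t r))).graph).Connected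

/-! ### Linear time-varying systems -/

/-- `z` solves `z' = M(s) z` on `[t₀, ∞)`. The coefficient `M` is meant to be piecewise constant
and right-continuous; then solutions are continuous, their right derivative is `M(s) z(s)` at
every `s ≥ t₀`, and, as consequences, they are differentiable off the jumps of `M`. -/
structure IsSolutionFrom {ι : Type*} [Fintype ι] [DecidableEq ι] (M : ℝ → Matrix ι ι ℝ) (t₀ : ℝ)
    (z : ℝ → EuclideanSpace ℝ ι) : Prop where
  continuousOn : ContinuousOn z (Set.Ici t₀)
  hasDeriv : ∀ s, t₀ ≤ s → HasDerivWithinAt z ((M s).toEuclideanLin (z s)) (Set.Ici s) s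

/-- (Uniform) exponential stability of `z' = M(s) z`, `s ≥ 0`, in the Euclidean norm: the constants
depend neither on the initial time nor on the initial state. -/
def ExponentiallyStable {ι : Type*} [Fintype ι] [DecidableEq ι] (M : ℝ → Matrix ι ι ℝ) : Prop :=
  ∃ κ > (0 : ℝ), ∃ lam > (0 : ℝ), ∀ t₀ ≥ (0 : ℝ), ∀ z : ℝ → EuclideanSpace ℝ ι,
    IsSolutionFrom M t₀ z → ∀ s ≥ t₀, ‖z s‖ ≤ κ * Real.exp (-lam * (s - t₀)) * ‖z t₀‖

/-! ### The block matrices of the switched system -/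

section Blocks

variable {N n : ℕ} {ν : Fin N → ℕ}

/-- `U = block diag{U₁, …, U_N}`, of size `Nn × ν` with `ν = ∑ ν_i`. -/
def blockU (U : ∀ i, Matrix (Fin n) (Fin (ν i)) ℝ) :
    Matrix (Fin N × Fin n) ((i : Fin N) × Fin (ν i)) ℝ :=
  (Matrix.blockDiagonal' U).submatrix (fun p => ⟨p.1, p.2⟩) id

/-- The block diagonal matrix of the unobservable blocks. Since `T_i = [D_i U_i]`, the lower right
block of `T_iᵀ A T_i` is `U_iᵀ A U_i`. -/
def blockA (A : Matrix (Fin n) (Fin n) ℝ) (U : ∀ i, Matrix (Fin n) (Fin (ν i)) ℝ) :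
    Matrix ((i : Fin N) × Fin (ν i)) ((i : Fin N) × Fin (ν i)) ℝ :=
  Matrix.blockDiagonal' fun i => (U i)ᵀ * A * U i

/-- `Γ = block diag{γ₁ I, …, γ_N I}`. -/
def blockGamma (ν : Fin N → ℕ) (γ : Fin N → ℝ) :
    Matrix ((i : Fin N) × Fin (ν i)) ((i : Fin N) × Fin (ν i)) ℝ :=
  Matrix.blockDiagonal' fun i => γ i • (1 : Matrix (Fin (ν i)) (Fin (ν i)) ℝ)

end Blocks

/-! Each unobservable subspace `K i = ker 𝒪_i` is `A`-invariant by Cayley–Hamilton. Since `A` is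
skew, the orthogonal projection `P i = U i * (U i)ᵀ` commutes with `A` and hence with the rotation
`exp (-sA)`. In the variables `y i = exp (-sA) (U i ζ i)`, which preserve the norm, the drift
disappears and a projected consensus flow remains: `y i ∈ K i` and `y i' = -γ i P i (∑ a_ij (y i - y
j))` (`IsSolutionFrom.isProjectedFlow`).

The energy `V = ∑ ‖y i‖² / γ i` satisfies `V' = -∑ a_ij ‖y i - y j‖²`, so it never increases. The
core is `exists_energy_le_mul_energy_loss`. If `V` loses less than `δ²` over a window of joint
connectivity, all states move by `O(δ)`, and each edge of the union graph has a moment at which its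
endpoints are `O(δ)` apart. By connectivity all states are then `O(δ)` apart at the start of the
window. Observability says `⨅ K i = ⊥`, so states `y i ∈ K i` that are this close together are
themselves `O(δ)`, and `V = O(δ²)`. Thus every window consumes a fixed fraction of `V`, and `V`
decays exponentially. -/

/-! ### Exponential decay of nonincreasing functions -/

/-- A nonnegative function that is nonincreasing on `[t₀, ∞)` and shrinks by a factor `ρ` over every
interval of length `h` decays exponentially. -/
theorem le_exp_mul_of_antitoneOn_of_contraction {f : ℝ → ℝ} {t₀ h ρ : ℝ} (hh : 0 < h)
    (hρ : 0 < ρ) (hρ1 : ρ < 1) (hf0 : 0 ≤ f t₀) (hanti : AntitoneOn f (Set.Ici t₀))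
    (hcontr : ∀ s, t₀ ≤ s → f (s + h) ≤ ρ * f s) {s : ℝ} (hs : t₀ ≤ s) :
    f s ≤ ρ⁻¹ * Real.exp (Real.log ρ / h * (s - t₀)) * f t₀ := by
  have hpow : ∀ q : ℕ, f (t₀ + q * h) ≤ ρ ^ q * f t₀ := by
    intro q
    induction q with
    | zero => simp
    | succ q ih =>
      have h1 := hcontr (t₀ + q * h) (by nlinarith [q.cast_nonneg (α := ℝ)])
      have h2 : t₀ + ((q + 1 : ℕ) : ℝ) * h = t₀ + q * h + h := by push_cast; ring
      rw [h2, pow_succ']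
      nlinarith
  set q := ⌊(s - t₀) / h⌋₊ with hq
  have hnn : 0 ≤ (s - t₀) / h := div_nonneg (by linarith) hh.le
  have hq1 : (q : ℝ) ≤ (s - t₀) / h := Nat.floor_le hnn
  have hq2 : (s - t₀) / h < q + 1 := Nat.lt_floor_add_one _
  have hq3 : q * h ≤ s - t₀ := (le_div_iff₀ hh).1 hq1
  have hlog : Real.log ρ < 0 := Real.log_neg hρ hρ1
  -- The factor `ρ⁻¹` pays for the last, incomplete interval: `q > (s - t₀) / h - 1` and `log ρ <
  -- 0`.
  have hle : ρ ^ q ≤ ρ⁻¹ * Real.exp (Real.log ρ / h * (s - t₀)) := by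
    have e1 : ρ ^ q = Real.exp (Real.log ρ * q) := by
      rw [Real.exp_mul, Real.exp_log hρ, Real.rpow_natCast]
    have e2 : ρ⁻¹ = Real.exp (-Real.log ρ) := by rw [Real.exp_neg, Real.exp_log hρ]
    rw [e1, e2, ← Real.exp_add]
    apply Real.exp_le_exp.2
    have : Real.log ρ / h * (s - t₀) = Real.log ρ * ((s - t₀) / h) := by ring
    rw [this]
    nlinarith
  calc f s ≤ f (t₀ + q * h) :=
        hanti (Set.mem_Ici.2 (by nlinarith [q.cast_nonneg (α := ℝ)])) hs (by linarith)
    _ ≤ ρ ^ q * f t₀ := hpow q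
    _ ≤ _ := mul_le_mul_of_nonneg_right hle hf0

/-- If the right derivative is at most `c` on `[a, b)`, then the increment is at most
`c * (b - a)`. -/
theorem sub_le_mul_sub_of_deriv_right_le {f f' : ℝ → ℝ} {a b c : ℝ} (hab : a ≤ b)
    (hf : ContinuousOn f (Set.Icc a b))
    (hf' : ∀ s ∈ Set.Ico a b, HasDerivWithinAt f (f' s) (Set.Ici s) s)
    (hc : ∀ s ∈ Set.Ico a b, f' s ≤ c) : f b - f a ≤ c * (b - a) := by
  have := image_le_of_deriv_right_le_deriv_boundary (B := fun s => f a + c * (s - a))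
    (B' := fun _ => c) hf hf' (by simp) (by fun_prop)
    (fun s _ => by
      simpa using ((((hasDerivAt_id s).sub_const a).const_mul c).const_add (f a)).hasDerivWithinAt)
    hc (Set.right_mem_Icc.2 hab)
  linarith

/-! ### Two coercivity estimates -/

/-- If subspaces of a finite-dimensional space have trivial intersection, then vectors of these
subspaces that are close to each other are small. -/
theorem exists_norm_le_mul_of_iInf_eq_bot {ι H : Type*} [Fintype ι] [NormedAddCommGroup H]
    [InnerProductSpace ℝ H] [FiniteDimensional ℝ H] (K : ι → Submodule ℝ H)
    (hK : ⨅ i, K i = ⊥) :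
    ∃ c > (0 : ℝ), ∀ y : ι → H, (∀ i, y i ∈ K i) → ∀ d, (∀ i j, ‖y i - y j‖ ≤ d) →
      ∀ i, ‖y i‖ ≤ c * d := by
  -- The components of `x` orthogonal to the `K i` vanish together only at `x = 0`; an injective
  -- linear map in finite dimension is bounded below.
  let f : H →ₗ[ℝ] (ι → H) :=
    LinearMap.pi fun i => ((K i)ᗮ.starProjection : H →ₗ[ℝ] H)
  have hf : LinearMap.ker f = ⊥ := by
    rw [eq_bot_iff, ← hK]
    intro x hx
    rw [Submodule.mem_iInf]
    intro i
    have h1 : (K i)ᗮ.starProjection x = 0 := congrFun (LinearMap.mem_ker.1 hx) i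
    rw [Submodule.starProjection_apply_eq_zero_iff, Submodule.orthogonal_orthogonal] at h1
    exact h1
  obtain ⟨c, hc, hanti⟩ := f.exists_antilipschitzWith hf
  refine ⟨c, by exact_mod_cast hc, fun y hy d hd i => ?_⟩
  have h1 : ‖y i‖ ≤ c * ‖f (y i)‖ := by
    have := hanti.le_mul_dist (y i) 0
    simpa using this
  refine h1.trans (mul_le_mul_of_nonneg_left ?_ c.2)
  refine (pi_norm_le_iff_of_nonneg ((norm_nonneg _).trans (hd i i))).2 fun j => ?_
  -- Subtracting `y j ∈ K j` does not change the component orthogonal to `K j`.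
  have h2 : f (y i) j = (K j)ᗮ.starProjection (y i - y j) := by
    have : (K j)ᗮ.starProjection (y j) = 0 := by
      rw [Submodule.starProjection_apply_eq_zero_iff, Submodule.orthogonal_orthogonal]
      exact hy j
    rw [map_sub, this, sub_zero]
    rfl
  rw [h2]
  exact ((K j)ᗮ.norm_starProjection_apply_le _).trans (hd i j)

/-- In a connected graph a bound on the differences along edges bounds all differences. -/
theorem SimpleGraph.Connected.norm_sub_le {ι H : Type*} [Fintype ι] [SeminormedAddCommGroup H]
    {G : SimpleGraph ι} (hG : G.Connected) {y : ι → H} {d : ℝ} (hd : 0 ≤ d)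
    (h : ∀ i j, G.Adj i j → ‖y i - y j‖ ≤ d) (i j : ι) :
    ‖y i - y j‖ ≤ Fintype.card ι * d := by
  have hwalk : ∀ {u v : ι} (p : G.Walk u v), ‖y u - y v‖ ≤ p.length * d := by
    intro u v p
    induction p with
    | nil => simp
    | @cons u v w huv p ih =>
      calc ‖y u - y w‖ ≤ ‖y u - y v‖ + ‖y v - y w‖ := norm_sub_le_norm_sub_add_norm_sub _ _ _
        _ ≤ d + p.length * d := add_le_add (h _ _ huv) ih
        _ = _ := by simp [SimpleGraph.Walk.length_cons]; ring
  -- A path repeats no vertex, which bounds its length by the number of vertices.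
  obtain ⟨p, hp⟩ := hG.exists_isPath i j
  refine (hwalk p).trans (mul_le_mul_of_nonneg_right ?_ hd)
  exact_mod_cast hp.length_lt.le

/-! ### Projected consensus flows -/

section Flow

variable {ι H : Type*} [Fintype ι] [NormedAddCommGroup H]

/-- The weighted energy `∑ ‖y i‖² / γ i`. -/
noncomputable def flowEnergy (γ : ι → ℝ) (y : ι → H) : ℝ := ∑ i, (γ i)⁻¹ * ‖y i‖ ^ 2

/-- The disagreement `∑ w i j ‖y i - y j‖²`. -/
noncomputable def disagreement (w : ι → ι → ℝ) (y : ι → H) : ℝ :=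
  ∑ i, ∑ j, w i j * ‖y i - y j‖ ^ 2

theorem disagreement_nonneg {w : ι → ι → ℝ} (hw : ∀ i j, 0 ≤ w i j) (y : ι → H) :
    0 ≤ disagreement w y :=
  Finset.sum_nonneg fun i _ => Finset.sum_nonneg fun j _ =>
    mul_nonneg (hw i j) (sq_nonneg _)

theorem mul_norm_sq_le_disagreement {w : ι → ι → ℝ} (hw : ∀ i j, 0 ≤ w i j) (y : ι → H)
    (i j : ι) : w i j * ‖y i - y j‖ ^ 2 ≤ disagreement w y := by
  have h0 : ∀ i j, 0 ≤ w i j * ‖y i - y j‖ ^ 2 := fun i j => mul_nonneg (hw i j) (sq_nonneg _)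
  exact (Finset.single_le_sum (f := fun j => w i j * ‖y i - y j‖ ^ 2)
    (fun j _ => h0 i j) (Finset.mem_univ j)).trans
    (Finset.single_le_sum (f := fun i => ∑ j, w i j * ‖y i - y j‖ ^ 2)
      (fun i _ => Finset.sum_nonneg fun j _ => h0 i j) (Finset.mem_univ i))

variable [InnerProductSpace ℝ H]

/-- Exchanging `i` and `j` and adding the two sums completes the square for each ordered pair. The
factor 2 matches the one in the derivative of `‖y i‖²`. -/
theorem two_mul_sum_inner_eq_disagreement {w : ι → ι → ℝ} (hw : ∀ i j, w i j = w j i)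
    (y : ι → H) :
    2 * ∑ i, inner ℝ (y i) (∑ j, w i j • (y i - y j)) = disagreement w y := by
  have h1 : ∑ i, inner ℝ (y i) (∑ j, w i j • (y i - y j))
      = ∑ i, ∑ j, w i j * inner ℝ (y i) (y i - y j) := by
    simp_rw [inner_sum, inner_smul_right]
  have h2 : ∑ i, ∑ j, w i j * inner ℝ (y i) (y i - y j)
      = ∑ i, ∑ j, w i j * inner ℝ (y j) (y j - y i) := by
    rw [Finset.sum_comm]
    refine Finset.sum_congr rfl fun i _ => Finset.sum_congr rfl fun j _ => ?_
    rw [hw]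
  rw [two_mul, h1]
  nth_rewrite 2 [h2]
  rw [disagreement, ← Finset.sum_add_distrib]
  refine Finset.sum_congr rfl fun i _ => ?_
  rw [← Finset.sum_add_distrib]
  refine Finset.sum_congr rfl fun j _ => ?_
  rw [← mul_add, ← real_inner_self_eq_norm_sq]
  congr 1
  simp only [inner_sub_left, inner_sub_right]
  rw [real_inner_comm (y i) (y j)]
  ring

variable [FiniteDimensional ℝ H]

/-- The states `y i` follow the consensus dynamics with weights `w`, gains `γ` and velocities
projected to the subspaces `K i`, on `[t₀, ∞)`. -/
structure IsProjectedFlow (K : ι → Submodule ℝ H) (γ : ι → ℝ) (w : ℝ → ι → ι → ℝ) (t₀ : ℝ)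
    (y : ι → ℝ → H) : Prop where
  continuousOn : ∀ i, ContinuousOn (y i) (Set.Ici t₀)
  mem : ∀ i s, t₀ ≤ s → y i s ∈ K i
  hasDeriv : ∀ i s, t₀ ≤ s → HasDerivWithinAt (y i)
    (-(γ i • (K i).starProjection (∑ j, w s i j • (y i s - y j s)))) (Set.Ici s) s

namespace IsProjectedFlow

variable {K : ι → Submodule ℝ H} {γ : ι → ℝ} {w : ℝ → ι → ι → ℝ} {t₀ : ℝ} {y : ι → ℝ → H}

theorem continuousOn_energy (h : IsProjectedFlow K γ w t₀ y) :
    ContinuousOn (fun s => flowEnergy γ fun i => y i s) (Set.Ici t₀) := by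
  unfold flowEnergy
  exact continuousOn_finsetSum _ fun i _ =>
    continuousOn_const.mul ((h.continuousOn i).norm.pow 2)

/-- The weight `(γ i)⁻¹` cancels the gain, and the projection drops out because it is self-adjoint
and fixes `y i`. -/
theorem hasDeriv_energy (h : IsProjectedFlow K γ w t₀ y) (hγ : ∀ i, 0 < γ i)
    (hw : ∀ s i j, w s i j = w s j i) {s : ℝ} (hs : t₀ ≤ s) :
    HasDerivWithinAt (fun s => flowEnergy γ fun i => y i s)
      (-disagreement (w s) fun i => y i s) (Set.Ici s) s := by
  have h1 : ∀ i, HasDerivWithinAt (fun s => (γ i)⁻¹ * ‖y i s‖ ^ 2)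
      (-(2 * inner ℝ (y i s) (∑ j, w s i j • (y i s - y j s)))) (Set.Ici s) s := by
    intro i
    refine (((h.hasDeriv i s hs).norm_sq).const_mul (γ i)⁻¹).congr_deriv ?_
    rw [inner_neg_right, inner_smul_right, ← Submodule.inner_starProjection_left_eq_right,
      Submodule.starProjection_eq_self_iff.2 (h.mem i s hs)]
    field_simp [(hγ i).ne']
  refine (HasDerivWithinAt.fun_sum (u := Finset.univ) fun i _ => h1 i).congr_deriv ?_
  rw [← two_mul_sum_inner_eq_disagreement (hw s), Finset.sum_neg_distrib, Finset.mul_sum]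

theorem antitoneOn_energy (h : IsProjectedFlow K γ w t₀ y) (hγ : ∀ i, 0 < γ i)
    (hw : ∀ s i j, w s i j = w s j i) (hw0 : ∀ s i j, 0 ≤ w s i j) :
    AntitoneOn (fun s => flowEnergy γ fun i => y i s) (Set.Ici t₀) := by
  intro a ha b hb hab
  have := sub_le_mul_sub_of_deriv_right_le (c := 0) hab
    (h.continuousOn_energy.mono fun s hs => le_trans ha hs.1)
    (fun s hs => h.hasDeriv_energy hγ hw (le_trans ha hs.1))
    (fun s _ => neg_nonpos.2 (disagreement_nonneg (hw0 s) _))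
  simpa using this

/-- The displacement of a state is controlled by the elapsed time and the loss of energy. -/
theorem norm_sub_le (h : IsProjectedFlow K γ w t₀ y) (hγ : ∀ i, 0 < γ i)
    (hw : ∀ s i j, w s i j = w s j i) (hw0 : ∀ s i j, 0 ≤ w s i j) {g W : ℝ}
    (hg : ∀ i, γ i ≤ g) (hW : ∀ s i j, w s i j ≤ W) {δ : ℝ} (hδ : 0 < δ) {a b : ℝ}
    (ha : t₀ ≤ a) (hab : a ≤ b) (i : ι) :
    ‖y i b - y i a‖ ≤ g * (Fintype.card ι * W * δ * (b - a) +
      δ⁻¹ * (flowEnergy γ (fun i => y i a) - flowEnergy γ fun i => y i b)) := by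
  have hcont : ∀ {f : ℝ → H}, ContinuousOn f (Set.Ici t₀) → ContinuousOn f (Set.Icc a b) :=
    fun hf => hf.mono fun s hs => le_trans ha hs.1
  -- Instead of integrating the speed, compare with `B`, whose right derivative dominates it; the
  -- dissipation enters `B` through the energy.
  refine image_norm_le_of_norm_deriv_right_le_deriv_boundary' (f := fun s => y i s - y i a)
    (f' := fun s => -(γ i • (K i).starProjection (∑ j, w s i j • (y i s - y j s))))
    (B := fun s => g * (Fintype.card ι * W * δ * (s - a) +
      δ⁻¹ * (flowEnergy γ (fun i => y i a) - flowEnergy γ fun i => y i s)))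
    (B' := fun s => g * (Fintype.card ι * W * δ +
      δ⁻¹ * disagreement (w s) fun i => y i s))
    ((hcont (h.continuousOn i)).sub continuousOn_const)
    (fun s hs => (h.hasDeriv i s (ha.trans hs.1)).sub_const _) (by simp) ?_ ?_ ?_
    (Set.right_mem_Icc.2 hab)
  · have := h.continuousOn_energy.mono (s := Set.Ici t₀) (t := Set.Icc a b)
      fun s hs => le_trans ha hs.1
    fun_prop
  · intro s hs
    have h1 := ((h.hasDeriv_energy hγ hw (ha.trans hs.1)).const_sub
      (flowEnergy γ fun i => y i a)).const_mul δ⁻¹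
    have h2 := ((((hasDerivAt_id s).sub_const a).const_mul
      (Fintype.card ι * W * δ)).hasDerivWithinAt (s := Set.Ici s))
    refine ((h2.add h1).const_mul g).congr_deriv ?_
    simp
  · intro s _
    have hterm : ∀ j, ‖w s i j • (y i s - y j s)‖
        ≤ W * δ + δ⁻¹ * (w s i j * ‖y i s - y j s‖ ^ 2) := by
      intro j
      rw [norm_smul, Real.norm_of_nonneg (hw0 s i j)]
      -- Young's inequality trades the difference for a constant plus a multiple of its square,
      -- which the dissipation controls.
      have hx : ‖y i s - y j s‖ ≤ δ + δ⁻¹ * ‖y i s - y j s‖ ^ 2 := by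
        rw [← sub_nonneg]
        have : δ + δ⁻¹ * ‖y i s - y j s‖ ^ 2 - ‖y i s - y j s‖ =
          δ⁻¹ * ((δ - ‖y i s - y j s‖ / 2) ^ 2 + 3 / 4 * ‖y i s - y j s‖ ^ 2) := by
          field_simp; ring
        rw [this]
        positivity
      calc w s i j * ‖y i s - y j s‖
          ≤ w s i j * (δ + δ⁻¹ * ‖y i s - y j s‖ ^ 2) :=
            mul_le_mul_of_nonneg_left hx (hw0 s i j)
        _ = w s i j * δ + δ⁻¹ * (w s i j * ‖y i s - y j s‖ ^ 2) := by ring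
        _ ≤ _ := by
          have := mul_le_mul_of_nonneg_right (hW s i j) hδ.le
          linarith
    have hrow : ∑ j, w s i j * ‖y i s - y j s‖ ^ 2 ≤ disagreement (w s) fun i => y i s :=
      Finset.single_le_sum (f := fun i => ∑ j, w s i j * ‖y i s - y j s‖ ^ 2)
        (fun i _ => Finset.sum_nonneg fun j _ => mul_nonneg (hw0 s i j) (sq_nonneg _))
        (Finset.mem_univ i)
    have hproj : ‖(K i).starProjection (∑ j, w s i j • (y i s - y j s))‖ ≤
        Fintype.card ι * W * δ + δ⁻¹ * disagreement (w s) fun i => y i s := by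
      calc _ ≤ ‖∑ j, w s i j • (y i s - y j s)‖ := (K i).norm_starProjection_apply_le _
        _ ≤ ∑ j, (W * δ + δ⁻¹ * (w s i j * ‖y i s - y j s‖ ^ 2)) :=
          norm_sum_le_of_le _ fun j _ => hterm j
        _ = Fintype.card ι * W * δ + δ⁻¹ * ∑ j, w s i j * ‖y i s - y j s‖ ^ 2 := by
          rw [Finset.sum_add_distrib, Finset.mul_sum, Finset.sum_const, Finset.card_univ,
            nsmul_eq_mul, mul_assoc _ W δ]
        _ ≤ _ := by gcongr
    rw [norm_neg, norm_smul, Real.norm_of_nonneg (hγ i).le]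
    exact mul_le_mul (hg i) hproj (norm_nonneg _) ((hγ i).le.trans (hg i))

end IsProjectedFlow

/-- Over a window in which the union of the active edges is connected, every edge being active with
weight at least `μ` for a time at least `τ`, a fixed proportion of the energy is lost. -/
theorem exists_energy_le_mul_energy_loss (K : ι → Submodule ℝ H) (hK : ⨅ i, K i = ⊥)
    {γ : ι → ℝ} (hγ : ∀ i, 0 < γ i) {W μ τ T : ℝ} (hμ : 0 < μ) (hτ : 0 < τ) (hT : 0 < T) :
    ∃ c > (1 : ℝ), ∀ (w : ℝ → ι → ι → ℝ) (t₀ : ℝ) (y : ι → ℝ → H),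
      IsProjectedFlow K γ w t₀ y → (∀ s i j, w s i j = w s j i) → (∀ s i j, 0 ≤ w s i j) →
      (∀ s i j, w s i j ≤ W) → ∀ a b, t₀ ≤ a → a ≤ b → b ≤ a + T →
      ∀ G : SimpleGraph ι, G.Connected →
      (∀ i j, G.Adj i j → ∃ p q, a ≤ p ∧ p + τ ≤ q ∧ q ≤ b ∧ ∀ s ∈ Set.Ico p q, μ ≤ w s i j) →
      flowEnergy γ (fun i => y i a) ≤
        c * (flowEnergy γ (fun i => y i a) - flowEnergy γ fun i => y i b) := by
  obtain ⟨c₁, hc₁, hsmall⟩ := exists_norm_le_mul_of_iInf_eq_bot K hK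
  set g := ∑ i, γ i
  have hg : ∀ i, γ i ≤ g := fun i =>
    Finset.single_le_sum (fun i _ => (hγ i).le) (Finset.mem_univ i)
  have hg0 : 0 ≤ g := Finset.sum_nonneg fun i _ => (hγ i).le
  set N : ℝ := (Fintype.card ι : ℝ) with hN
  have hN0 : 0 ≤ N := Nat.cast_nonneg _
  -- `c₂ * δ` bounds the displacement of a state in the window, `c₃ * δ` the initial difference
  -- along an edge, and `c₄ * δ ^ 2` the initial energy.
  set c₂ := g * (N * W * T + 1) with hc₂
  set c₃ := √((μ * τ)⁻¹) + 2 * c₂ with hc₃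
  set c₄ := (∑ i, (γ i)⁻¹) * (c₁ * (N * c₃)) ^ 2 with hc₄
  have hc₄0 : 0 ≤ c₄ := mul_nonneg (Finset.sum_nonneg fun i _ => (inv_pos.2 (hγ i)).le)
    (sq_nonneg _)
  refine ⟨c₄ + 2, by linarith, ?_⟩
  intro w t₀ y hy hw hw0 hW a b ha hab hbT G hG hedge
  set V := fun s => flowEnergy γ fun i => y i s with hV
  have hanti : AntitoneOn V (Set.Ici t₀) := hy.antitoneOn_energy hγ hw hw0
  have hloss0 : 0 ≤ V a - V b := sub_nonneg.2 (hanti ha (ha.trans hab) hab)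
  -- A strict bound by a free `δ > 0` keeps `δ⁻¹` meaningful when the loss is zero; `δ ^ 2` is later
  -- brought down to the loss.
  have hmain : ∀ δ : ℝ, 0 < δ → V a - V b < δ ^ 2 → V a ≤ c₄ * δ ^ 2 := by
    intro δ hδ hlt
    obtain ⟨i₀⟩ := hG.nonempty
    have hW0 : 0 ≤ W := (hw0 a i₀ i₀).trans (hW a i₀ i₀)
    have hc₂0 : 0 ≤ c₂ := by positivity
    have hc₃0 : 0 ≤ c₃ := by positivity
    have hmove : ∀ s, a ≤ s → s ≤ b → ∀ i, ‖y i s - y i a‖ ≤ c₂ * δ := by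
      intro s has hsb i
      refine (hy.norm_sub_le hγ hw hw0 hg hW hδ ha has i).trans ?_
      have h1 : V a - V s ≤ δ ^ 2 := by
        have : V b ≤ V s := hanti (ha.trans has) (ha.trans hab) hsb
        linarith
      have h2 : δ⁻¹ * (V a - V s) ≤ δ := by
        calc δ⁻¹ * (V a - V s) ≤ δ⁻¹ * δ ^ 2 := by gcongr
          _ = δ := by field_simp
      calc g * (N * W * δ * (s - a) + δ⁻¹ * (V a - V s))
          ≤ g * (N * W * δ * T + δ) := by
            gcongr
            linarith
        _ = c₂ * δ := by rw [hc₂]; ring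
    have hadj : ∀ i j, G.Adj i j → ‖y i a - y j a‖ ≤ c₃ * δ := by
      intro i j hij
      obtain ⟨p, q, hap, hpq, hqb, hact⟩ := hedge i j hij
      -- Otherwise the energy would fall at rate at least `δ ^ 2 / τ` for a time at least `τ`, a
      -- loss of at least `δ ^ 2`.
      obtain ⟨s, hs, hsd⟩ : ∃ s ∈ Set.Ico p q, μ * ‖y i s - y j s‖ ^ 2 < δ ^ 2 / τ := by
        by_contra! hcon
        have hpq' : p ≤ q := by linarith
        have h1 : V q - V p ≤ -(δ ^ 2 / τ) * (q - p) :=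
          sub_le_mul_sub_of_deriv_right_le hpq'
            (hy.continuousOn_energy.mono fun s hs => (ha.trans hap).trans hs.1)
            (fun s hs => hy.hasDeriv_energy hγ hw ((ha.trans hap).trans hs.1))
            (fun s hs => neg_le_neg ((hcon s hs).trans
              ((mul_le_mul_of_nonneg_right (hact s hs) (sq_nonneg _)).trans
                (mul_norm_sq_le_disagreement (hw0 s) (fun i => y i s) i j))))
        have h2 : δ ^ 2 ≤ δ ^ 2 / τ * (q - p) := by
          calc δ ^ 2 = δ ^ 2 / τ * τ := by field_simp
            _ ≤ _ := by gcongr; linarith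
        have h3 : V p ≤ V a := hanti ha (ha.trans hap) hap
        have h4 : V b ≤ V q :=
          hanti ((ha.trans hap).trans hpq') (ha.trans hab) hqb
        linarith
      have hsd' : ‖y i s - y j s‖ ≤ √((μ * τ)⁻¹) * δ := by
        rw [← Real.sqrt_sq hδ.le, ← Real.sqrt_mul (by positivity)]
        refine Real.le_sqrt_of_sq_le ?_
        rw [inv_mul_eq_div, le_div_iff₀ (by positivity)]
        rw [lt_div_iff₀ hτ] at hsd
        linarith
      have has : a ≤ s := hap.trans hs.1
      have hsb : s ≤ b := hs.2.le.trans hqb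
      have h1 := hmove s has hsb i
      have h2 := hmove s has hsb j
      calc ‖y i a - y j a‖
          = ‖(y i s - y j s) - (y i s - y i a) + (y j s - y j a)‖ := by congr 1; abel
        _ ≤ ‖y i s - y j s‖ + ‖y i s - y i a‖ + ‖y j s - y j a‖ :=
          (norm_add_le _ _).trans (add_le_add_left (_root_.norm_sub_le _ _) _)
        _ ≤ √((μ * τ)⁻¹) * δ + c₂ * δ + c₂ * δ := by linarith
        _ = c₃ * δ := by rw [hc₃]; ring
    have hall := hG.norm_sub_le (y := fun i => y i a) (by positivity) hadj
    have hbd := hsmall (fun i => y i a) (fun i => hy.mem i a ha) _ hall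
    calc V a ≤ ∑ i, (γ i)⁻¹ * (c₁ * (N * (c₃ * δ))) ^ 2 := by
          refine Finset.sum_le_sum fun i _ => ?_
          have := hbd i
          have := (inv_pos.2 (hγ i)).le
          gcongr
      _ = c₄ * δ ^ 2 := by rw [← Finset.sum_mul, hc₄]; ring
  have hV : V a ≤ c₄ * (V a - V b) := by
    refine le_of_forall_pos_le_add fun ε hε => ?_
    have hη : 0 < ε / (c₄ + 1) := by positivity
    have h1 := hmain (√(V a - V b + ε / (c₄ + 1))) (Real.sqrt_pos.2 (by linarith))
      (by rw [Real.sq_sqrt (by linarith)]; linarith)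
    rw [Real.sq_sqrt (by linarith), mul_add] at h1
    have h2 : c₄ * (ε / (c₄ + 1)) ≤ ε := by
      rw [← mul_div_assoc, div_le_iff₀ (by linarith)]
      nlinarith
    linarith
  linarith

end Flow

/-! ### The unobservable subspace -/

theorem obsMatrix_mulVec_eq_zero_iff {n : ℕ} {p : Type*} {C : Matrix p (Fin n) ℝ}
    {A : Matrix (Fin n) (Fin n) ℝ} {v : Fin n → ℝ} :
    obsMatrix C A *ᵥ v = 0 ↔ ∀ k < n, (C * A ^ k) *ᵥ v = 0 := by
  constructor
  · intro h k hk
    funext r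
    exact congrFun h (⟨k, hk⟩, r)
  · intro h
    funext kr
    exact congrFun (h kr.1 kr.1.2) kr.2

/-- By the Cayley–Hamilton theorem, the outputs `C * A ^ k` with `k ≥ n` vanish on the unobservable
subspace as well. -/
theorem mul_pow_mulVec_eq_zero_of_obsMatrix {n : ℕ} {p : Type*} {C : Matrix p (Fin n) ℝ}
    {A : Matrix (Fin n) (Fin n) ℝ} {v : Fin n → ℝ} (h : obsMatrix C A *ᵥ v = 0) (k : ℕ) :
    (C * A ^ k) *ᵥ v = 0 := by
  -- For `n = 0` the remainder has `natDegree` 0, which is not below `n`.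
  rcases Nat.eq_zero_or_pos n with rfl | hn
  · rw [Subsingleton.elim v 0, mulVec_zero]
  have hdeg : (Polynomial.X ^ k %ₘ A.charpoly).natDegree < n := by
    have h1 := Polynomial.natDegree_modByMonic_lt (Polynomial.X ^ k) A.charpoly_monic
      (fun h1 => by
        have := A.charpoly_natDegree_eq_dim
        rw [h1] at this
        simp at this
        omega)
    rwa [A.charpoly_natDegree_eq_dim, Fintype.card_fin] at h1
  rw [A.pow_eq_aeval_mod_charpoly, Polynomial.aeval_eq_sum_range' hdeg, Matrix.mul_sum,
    Matrix.sum_mulVec]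
  refine Finset.sum_eq_zero fun l hl => ?_
  rw [Matrix.mul_smul, Matrix.smul_mulVec,
    obsMatrix_mulVec_eq_zero_iff.1 h l (Finset.mem_range.1 hl), smul_zero]

/-- Applying `A` shifts the exponents up by one, and only the new exponent `n` needs
Cayley–Hamilton. -/
theorem obsMatrix_mulVec_mulVec_eq_zero {n : ℕ} {p : Type*} {C : Matrix p (Fin n) ℝ}
    {A : Matrix (Fin n) (Fin n) ℝ} {v : Fin n → ℝ} (h : obsMatrix C A *ᵥ v = 0) :
    obsMatrix C A *ᵥ (A *ᵥ v) = 0 := by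
  rw [obsMatrix_mulVec_eq_zero_iff]
  intro k _
  rw [mulVec_mulVec, Matrix.mul_assoc, ← pow_succ]
  exact mul_pow_mulVec_eq_zero_of_obsMatrix h (k + 1)

theorem IsObservable.eq_zero {n : ℕ} {p : Type*} {C : Matrix p (Fin n) ℝ}
    {A : Matrix (Fin n) (Fin n) ℝ} (hobs : IsObservable C A) {v : Fin n → ℝ}
    (h : obsMatrix C A *ᵥ v = 0) : v = 0 := by
  have h1 := (obsMatrix C A).mulVecLin.finrank_range_add_finrank_ker
  have h2 : Module.finrank ℝ (LinearMap.range (obsMatrix C A).mulVecLin) = n := hobs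
  rw [h2, Module.finrank_fin_fun] at h1
  have h3 : LinearMap.ker (obsMatrix C A).mulVecLin = ⊥ :=
    Submodule.finrank_eq_zero.1 (by omega)
  have h4 : v ∈ LinearMap.ker (obsMatrix C A).mulVecLin := h
  rwa [h3, Submodule.mem_bot] at h4

theorem obsMatrix_stackedOutput_mulVec_eq_zero {N n : ℕ} {m : Fin N → ℕ}
    {C : ∀ i, Matrix (Fin (m i)) (Fin n) ℝ} {A : Matrix (Fin n) (Fin n) ℝ} {v : Fin n → ℝ}
    (h : ∀ i, obsMatrix (C i) A *ᵥ v = 0) : obsMatrix (stackedOutput C) A *ᵥ v = 0 := by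
  funext kr
  exact congrFun (h kr.2.1) (kr.1, kr.2.2)

namespace IsUnobservableBasis

variable {n d : ℕ} {p : Type*} {C : Matrix p (Fin n) ℝ} {A : Matrix (Fin n) (Fin n) ℝ}
  {U : Matrix (Fin n) (Fin d) ℝ}

theorem obsMatrix_mulVec_mulVec (hU : IsUnobservableBasis C A U) (v : Fin d → ℝ) :
    obsMatrix C A *ᵥ (U *ᵥ v) = 0 := by
  have h : U *ᵥ v ∈ LinearMap.range U.mulVecLin := ⟨v, rfl⟩
  rw [hU.range_eq] at h
  exact h

/-- By invariance the columns of `A * U` lie in the range of `U`, which `U * Uᵀ` fixes pointwise. -/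
theorem mul_eq (hU : IsUnobservableBasis C A U) : U * Uᵀ * A * U = A * U := by
  refine Matrix.ext_of_mulVec_single fun k => ?_
  set v : Fin d → ℝ := Pi.single k 1
  have h : A *ᵥ (U *ᵥ v) ∈ LinearMap.range U.mulVecLin := by
    rw [hU.range_eq]
    exact obsMatrix_mulVec_mulVec_eq_zero (hU.obsMatrix_mulVec_mulVec v)
  obtain ⟨u, hu⟩ := h
  have hu' : U *ᵥ u = A *ᵥ (U *ᵥ v) := hu
  simp only [← mulVec_mulVec]
  rw [← hu', mulVec_mulVec, mulVec_mulVec, Matrix.mul_assoc, hU.orthonormal, Matrix.mul_one]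

/-- For skew-symmetric `A`, the projection to the unobservable subspace commutes with `A`. -/
theorem commute (hU : IsUnobservableBasis C A U) (hA : Aᵀ = -A) : Commute A (U * Uᵀ) := by
  -- Skewness turns the transposed identity into `Uᵀ * A * (U * Uᵀ) = Uᵀ * A`; with `P = U * Uᵀ`,
  -- both `A * P` and `P * A` equal `P * A * P`.
  have h1 := congrArg Matrix.transpose hU.mul_eq
  simp only [Matrix.transpose_mul, Matrix.transpose_transpose, hA, Matrix.neg_mul,
    Matrix.mul_neg, neg_inj] at h1
  have h2 : A * (U * Uᵀ) = U * Uᵀ * A * U * Uᵀ := by rw [hU.mul_eq, Matrix.mul_assoc]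
  have h3 : U * Uᵀ * A = U * Uᵀ * A * U * Uᵀ := by
    conv_lhs => rw [Matrix.mul_assoc, ← h1]
    simp only [Matrix.mul_assoc]
  exact h2.trans h3.symm

/-- The unobservable subspace, inside Euclidean space, is the range of `U`, and `U * Uᵀ` is the
orthogonal projection to it. -/
theorem starProjection_apply (hU : IsUnobservableBasis C A U) (x : EuclideanSpace ℝ (Fin n)) :
    (LinearMap.range U.toEuclideanLin).starProjection x
      = Matrix.toEuclideanCLM (n := Fin n) (𝕜 := ℝ) (U * Uᵀ) x := by
  refine Submodule.eq_starProjection_of_mem_of_inner_eq_zero ?_ ?_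
  · refine ⟨WithLp.toLp 2 (Uᵀ *ᵥ x.ofLp), ?_⟩
    ext a
    simp [← mulVec_mulVec]
  · rintro _ ⟨u, rfl⟩
    have h : (x.ofLp - (U * Uᵀ) *ᵥ x.ofLp) ⬝ᵥ U *ᵥ u.ofLp = 0 := by
      rw [dotProduct_mulVec, ← mulVec_transpose, mulVec_sub, mulVec_mulVec, ← Matrix.mul_assoc,
        hU.orthonormal, Matrix.one_mul, sub_self, zero_dotProduct]
    rw [EuclideanSpace.inner_eq_star_dotProduct, dotProduct_comm]
    exact h

end IsUnobservableBasis

/-! ### The blocks of the system matrix -/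

section

variable {N n : ℕ} {ν : Fin N → ℕ}

theorem blockDiagonal'_mulVec_apply {o : Type*} [Fintype o] [DecidableEq o] {m' n' : o → Type*}
    [∀ i, Fintype (n' i)] {R : Type*} [NonUnitalNonAssocSemiring R]
    (M : ∀ i, Matrix (m' i) (n' i) R) (v : (Σ i, n' i) → R) (i : o) (a : m' i) :
    (Matrix.blockDiagonal' M *ᵥ v) ⟨i, a⟩ = (M i *ᵥ fun k => v ⟨i, k⟩) a := by
  rw [mulVec, dotProduct, Fintype.sum_sigma, Finset.sum_eq_single i]
  · simp [mulVec, dotProduct, Matrix.blockDiagonal'_apply_eq]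
  · intro j _ hj
    refine Finset.sum_eq_zero fun k _ => ?_
    rw [Matrix.blockDiagonal'_apply_ne _ _ _ (Ne.symm hj), zero_mul]
  · simp

theorem blockU_mulVec_apply (U : ∀ i, Matrix (Fin n) (Fin (ν i)) ℝ)
    (v : ((i : Fin N) × Fin (ν i)) → ℝ) (i : Fin N) (a : Fin n) :
    (blockU U *ᵥ v) (i, a) = (U i *ᵥ fun k => v ⟨i, k⟩) a :=
  blockDiagonal'_mulVec_apply U v i a

theorem blockU_transpose_mulVec_apply (U : ∀ i, Matrix (Fin n) (Fin (ν i)) ℝ)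
    (u : Fin N × Fin n → ℝ) (i : Fin N) (k : Fin (ν i)) :
    ((blockU U)ᵀ *ᵥ u) ⟨i, k⟩ = ((U i)ᵀ *ᵥ fun a => u (i, a)) k := by
  rw [mulVec, dotProduct, Fintype.sum_prod_type, Finset.sum_eq_single i]
  · simp [mulVec, dotProduct, blockU]
  · intro j _ hj
    refine Finset.sum_eq_zero fun a _ => ?_
    simp [blockU, Matrix.blockDiagonal'_apply_ne _ _ _ hj]
  · simp

theorem blockGamma_mulVec_apply (γ : Fin N → ℝ) (v : ((i : Fin N) × Fin (ν i)) → ℝ) (i : Fin N)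
    (k : Fin (ν i)) : (blockGamma ν γ *ᵥ v) ⟨i, k⟩ = γ i * v ⟨i, k⟩ := by
  rw [blockGamma, blockDiagonal'_mulVec_apply, smul_mulVec, one_mulVec]
  rfl

theorem kronecker_one_mulVec_apply (L : Matrix (Fin N) (Fin N) ℝ) (u : Fin N × Fin n → ℝ)
    (i : Fin N) (a : Fin n) :
    ((L ⊗ₖ (1 : Matrix (Fin n) (Fin n) ℝ)) *ᵥ u) (i, a) = ∑ j, L i j * u (j, a) := by
  rw [mulVec, dotProduct, Fintype.sum_prod_type]
  refine Finset.sum_congr rfl fun j _ => ?_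
  simp [Matrix.kroneckerMap_apply, Matrix.one_apply]

theorem WeightedGraph.sum_laplacian_mul {V : Type*} [Fintype V] [DecidableEq V]
    (G : WeightedGraph V) (u : V → ℝ) (i : V) :
    ∑ j, G.laplacian i j * u j = ∑ j, G.weight i j * (u i - u j) := by
  have h : ∀ j, G.laplacian i j * u j
      = (if i = j then (∑ k, G.weight i k) * u j else 0) - G.weight i j * u j := by
    intro j
    by_cases hij : i = j
    · subst hij
      simp [laplacian, G.weight_diag]
    · simp [laplacian, hij]
  simp_rw [h, mul_sub, Finset.sum_sub_distrib]
  simp [Finset.sum_mul]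

/-- In the coordinates `x i = U i * v i` the system decouples into `A` acting on each `x i` and a
projected consensus term. -/
theorem mulVec_system_block {p : Fin N → Type*} {A : Matrix (Fin n) (Fin n) ℝ}
    {C : ∀ i, Matrix (p i) (Fin n) ℝ} {U : ∀ i, Matrix (Fin n) (Fin (ν i)) ℝ}
    (hU : ∀ i, IsUnobservableBasis (C i) A (U i)) (γ : Fin N → ℝ) (G : WeightedGraph (Fin N))
    (v : ((i : Fin N) × Fin (ν i)) → ℝ) (i : Fin N) :
    (U i *ᵥ fun k => ((blockA A U - blockGamma ν γ * (blockU U)ᵀ *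
        (G.laplacian ⊗ₖ (1 : Matrix (Fin n) (Fin n) ℝ)) * blockU U) *ᵥ v) ⟨i, k⟩)
      = A *ᵥ (U i *ᵥ fun k => v ⟨i, k⟩) - γ i • ((U i * (U i)ᵀ) *ᵥ
        ∑ j, G.weight i j • ((U i *ᵥ fun k => v ⟨i, k⟩) - U j *ᵥ fun k => v ⟨j, k⟩)) := by
  have hL : (fun a => ((G.laplacian ⊗ₖ (1 : Matrix (Fin n) (Fin n) ℝ)) *ᵥ (blockU U *ᵥ v)) (i, a))
      = ∑ j, G.weight i j • ((U i *ᵥ fun k => v ⟨i, k⟩) - U j *ᵥ fun k => v ⟨j, k⟩) := by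
    funext a
    rw [kronecker_one_mulVec_apply, G.sum_laplacian_mul (fun j => (blockU U *ᵥ v) (j, a))]
    simp [blockU_mulVec_apply]
  have h : (fun k => ((blockA A U - blockGamma ν γ * (blockU U)ᵀ *
        (G.laplacian ⊗ₖ (1 : Matrix (Fin n) (Fin n) ℝ)) * blockU U) *ᵥ v) ⟨i, k⟩)
      = ((U i)ᵀ * A * U i) *ᵥ (fun k => v ⟨i, k⟩) - γ i • ((U i)ᵀ *ᵥ
        ∑ j, G.weight i j • ((U i *ᵥ fun k => v ⟨i, k⟩) - U j *ᵥ fun k => v ⟨j, k⟩)) := by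
    funext k
    rw [sub_mulVec, ← mulVec_mulVec, ← mulVec_mulVec, ← mulVec_mulVec, Pi.sub_apply,
      blockGamma_mulVec_apply, blockU_transpose_mulVec_apply, hL, blockA,
      blockDiagonal'_mulVec_apply]
    rfl
  rw [h, mulVec_sub, mulVec_smul, mulVec_mulVec, mulVec_mulVec, mulVec_mulVec,
    ← (hU i).mul_eq]
  simp only [Matrix.mul_assoc]

end

/-! ### Passing to a rotating frame -/

section

variable {N n : ℕ} {ν : Fin N → ℕ}

/-- The map `ζ ↦ U i * ζ i`. -/
noncomputable def blockEmbedding (U : ∀ i, Matrix (Fin n) (Fin (ν i)) ℝ) (i : Fin N) :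
    EuclideanSpace ℝ ((i : Fin N) × Fin (ν i)) →L[ℝ] EuclideanSpace ℝ (Fin n) :=
  LinearMap.toContinuousLinearMap
    (Matrix.toEuclideanLin ((blockU U).submatrix (fun a : Fin n => (i, a)) id))

theorem blockEmbedding_apply (U : ∀ i, Matrix (Fin n) (Fin (ν i)) ℝ) (i : Fin N)
    (z : EuclideanSpace ℝ ((i : Fin N) × Fin (ν i))) :
    blockEmbedding U i z = WithLp.toLp 2 (U i *ᵥ fun k => z.ofLp ⟨i, k⟩) := by
  ext a
  exact blockU_mulVec_apply U z.ofLp i a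

theorem blockEmbedding_mem_range (U : ∀ i, Matrix (Fin n) (Fin (ν i)) ℝ) (i : Fin N)
    (z : EuclideanSpace ℝ ((i : Fin N) × Fin (ν i))) :
    blockEmbedding U i z ∈ LinearMap.range (U i).toEuclideanLin :=
  ⟨WithLp.toLp 2 fun k => z.ofLp ⟨i, k⟩, by rw [blockEmbedding_apply]; rfl⟩

theorem sum_norm_blockEmbedding_sq {p : Fin N → Type*} {A : Matrix (Fin n) (Fin n) ℝ}
    {C : ∀ i, Matrix (p i) (Fin n) ℝ} {U : ∀ i, Matrix (Fin n) (Fin (ν i)) ℝ}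
    (hU : ∀ i, IsUnobservableBasis (C i) A (U i))
    (z : EuclideanSpace ℝ ((i : Fin N) × Fin (ν i))) :
    ∑ i, ‖blockEmbedding U i z‖ ^ 2 = ‖z‖ ^ 2 := by
  rw [EuclideanSpace.norm_sq_eq, Fintype.sum_sigma]
  refine Finset.sum_congr rfl fun i _ => ?_
  set v : Fin (ν i) → ℝ := fun k => z.ofLp ⟨i, k⟩
  have h : (U i *ᵥ v) ⬝ᵥ (U i *ᵥ v) = v ⬝ᵥ v := by
    rw [dotProduct_mulVec, ← mulVec_transpose, mulVec_mulVec, (hU i).orthonormal, one_mulVec]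
  rw [blockEmbedding_apply, EuclideanSpace.norm_sq_eq]
  simpa [dotProduct, sq] using h

theorem blockEmbedding_system {p : Fin N → Type*} {A : Matrix (Fin n) (Fin n) ℝ}
    {C : ∀ i, Matrix (p i) (Fin n) ℝ} {U : ∀ i, Matrix (Fin n) (Fin (ν i)) ℝ}
    (hU : ∀ i, IsUnobservableBasis (C i) A (U i)) (γ : Fin N → ℝ) (G : WeightedGraph (Fin N))
    (z : EuclideanSpace ℝ ((i : Fin N) × Fin (ν i))) (i : Fin N) :
    blockEmbedding U i ((blockA A U - blockGamma ν γ * (blockU U)ᵀ *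
        (G.laplacian ⊗ₖ (1 : Matrix (Fin n) (Fin n) ℝ)) * blockU U).toEuclideanLin z)
      = Matrix.toEuclideanCLM (n := Fin n) (𝕜 := ℝ) A (blockEmbedding U i z) - γ i •
        (LinearMap.range (U i).toEuclideanLin).starProjection
          (∑ j, G.weight i j • (blockEmbedding U i z - blockEmbedding U j z)) := by
  rw [(hU i).starProjection_apply, blockEmbedding_apply]
  refine (congrArg (WithLp.toLp 2) (mulVec_system_block hU γ G z.ofLp i)).trans ?_
  have hs : WithLp.ofLp (∑ j, G.weight i j • (blockEmbedding U i z - blockEmbedding U j z))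
      = ∑ j, G.weight i j • ((U i *ᵥ fun k => z.ofLp ⟨i, k⟩) -
          U j *ᵥ fun k => z.ofLp ⟨j, k⟩) := by
    simp only [blockEmbedding_apply, WithLp.ofLp_sum, WithLp.ofLp_smul, WithLp.ofLp_sub]
  rw [← hs, blockEmbedding_apply]
  rfl

/-- Observability enters the argument here: a vector unobservable from every node is killed by the
stacked observability matrix. -/
theorem iInf_range_eq_bot {m : Fin N → ℕ} {A : Matrix (Fin n) (Fin n) ℝ}
    {C : ∀ i, Matrix (Fin (m i)) (Fin n) ℝ} (hobs : IsObservable (stackedOutput C) A)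
    {U : ∀ i, Matrix (Fin n) (Fin (ν i)) ℝ} (hU : ∀ i, IsUnobservableBasis (C i) A (U i)) :
    ⨅ i, LinearMap.range (U i).toEuclideanLin = ⊥ := by
  rw [eq_bot_iff]
  intro x hx
  rw [Submodule.mem_iInf] at hx
  have h : x.ofLp = 0 := by
    refine hobs.eq_zero (obsMatrix_stackedOutput_mulVec_eq_zero fun i => ?_)
    obtain ⟨u, rfl⟩ := hx i
    exact (hU i).obsMatrix_mulVec_mulVec u.ofLp
  rw [Submodule.mem_bot]
  ext a
  exact congrFun h a

theorem Commute.apply_exp_smul_apply {H : Type*} [NormedAddCommGroup H] [NormedSpace ℝ H]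
    {P a : H →L[ℝ] H} (h : Commute P a) (s : ℝ) (x : H) :
    P (NormedSpace.exp (s • a) x) = NormedSpace.exp (s • a) (P x) := by
  have hs : Commute P (s • a) := by
    ext v
    have hv : P (a v) = a (P v) := DFunLike.congr_fun h.eq v
    simp only [mul_apply_eq_comp, _root_.smul_apply, map_smul, hv]
  have he : P * NormedSpace.exp (s • a) = NormedSpace.exp (s • a) * P := hs.exp_right.eq
  have hx := DFunLike.congr_fun he x
  simpa only [mul_apply_eq_comp] using hx

/-- The rotation `exp (-sA)`. -/
noncomputable def skewFlow (A : Matrix (Fin n) (Fin n) ℝ) (s : ℝ) :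
    EuclideanSpace ℝ (Fin n) →L[ℝ] EuclideanSpace ℝ (Fin n) :=
  NormedSpace.exp (s • -Matrix.toEuclideanCLM (n := Fin n) (𝕜 := ℝ) A)

/-- The generator is skew-adjoint, so its exponential is unitary. -/
theorem norm_skewFlow_apply {A : Matrix (Fin n) (Fin n) ℝ} (hA : Aᵀ = -A) (s : ℝ)
    (x : EuclideanSpace ℝ (Fin n)) : ‖skewFlow A s x‖ = ‖x‖ := by
  refine ContinuousLinearMap.norm_map_of_mem_unitary ?_ x
  let _ : NormedAlgebra ℚ (EuclideanSpace ℝ (Fin n) →L[ℝ] EuclideanSpace ℝ (Fin n)) :=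
    NormedAlgebra.restrictScalars ℚ ℝ _
  refine NormedSpace.exp_mem_unitary_of_mem_skewAdjoint ?_
  rw [skewAdjoint.mem_iff, star_smul, star_neg, ← map_star, Matrix.star_eq_conjTranspose,
    Matrix.conjTranspose_eq_transpose_of_trivial, hA, map_neg, neg_neg, star_trivial, smul_neg,
    neg_neg]

theorem hasDerivAt_skewFlow (A : Matrix (Fin n) (Fin n) ℝ) (s : ℝ) :
    HasDerivAt (skewFlow A)
      (skewFlow A s * -Matrix.toEuclideanCLM (n := Fin n) (𝕜 := ℝ) A) s :=
  hasDerivAt_exp_smul_const (𝔸 := EuclideanSpace ℝ (Fin n) →L[ℝ] EuclideanSpace ℝ (Fin n))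
    (-Matrix.toEuclideanCLM (n := Fin n) (𝕜 := ℝ) A) s

theorem IsUnobservableBasis.starProjection_skewFlow {d : ℕ} {p : Type*} {C : Matrix p (Fin n) ℝ}
    {A : Matrix (Fin n) (Fin n) ℝ} {U : Matrix (Fin n) (Fin d) ℝ}
    (hU : IsUnobservableBasis C A U) (hA : Aᵀ = -A) (s : ℝ) (x : EuclideanSpace ℝ (Fin n)) :
    (LinearMap.range U.toEuclideanLin).starProjection (skewFlow A s x)
      = skewFlow A s ((LinearMap.range U.toEuclideanLin).starProjection x) := by
  rw [hU.starProjection_apply, hU.starProjection_apply]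
  have h : Commute (Matrix.toEuclideanCLM (n := Fin n) (𝕜 := ℝ) (U * Uᵀ))
      (-Matrix.toEuclideanCLM (n := Fin n) (𝕜 := ℝ) A) :=
    ((hU.commute hA).map (Matrix.toEuclideanCLM (n := Fin n) (𝕜 := ℝ))).symm.neg_right
  exact h.apply_exp_smul_apply s x

/-- In the rotating frame, solutions of the switched system are projected consensus flows. -/
theorem IsSolutionFrom.isProjectedFlow {p : Fin N → Type*} {A : Matrix (Fin n) (Fin n) ℝ}
    (hA : Aᵀ = -A) {C : ∀ i, Matrix (p i) (Fin n) ℝ} {U : ∀ i, Matrix (Fin n) (Fin (ν i)) ℝ}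
    (hU : ∀ i, IsUnobservableBasis (C i) A (U i)) {γ : Fin N → ℝ} {G : ℝ → WeightedGraph (Fin N)}
    {t₀ : ℝ} {z : ℝ → EuclideanSpace ℝ ((i : Fin N) × Fin (ν i))}
    (hz : IsSolutionFrom (fun s => blockA A U - blockGamma ν γ * (blockU U)ᵀ *
        ((G s).laplacian ⊗ₖ (1 : Matrix (Fin n) (Fin n) ℝ)) * blockU U) t₀ z) :
    IsProjectedFlow (fun i => LinearMap.range (U i).toEuclideanLin) γ (fun s => (G s).weight) t₀
      (fun i s => skewFlow A s (blockEmbedding U i (z s))) where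
  continuousOn i := by
    have h1 : Continuous (skewFlow A) :=
      continuous_iff_continuousAt.2 fun s => (hasDerivAt_skewFlow A s).continuousAt
    exact h1.continuousOn.clm_apply ((blockEmbedding U i).continuous.comp_continuousOn
      hz.continuousOn)
  mem i s _ := by
    rw [← Submodule.starProjection_eq_self_iff, (hU i).starProjection_skewFlow hA,
      Submodule.starProjection_eq_self_iff.2 (blockEmbedding_mem_range U i (z s))]
  hasDeriv i s hs := by
    have h1 := (blockEmbedding U i).hasFDerivAt.comp_hasDerivWithinAt s (hz.hasDeriv s hs)
    -- In the product rule, the derivative of the rotation cancels the drift `A`.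
    have h2 := ((hasDerivAt_skewFlow A s).hasDerivWithinAt (s := Set.Ici s)).clm_apply h1
    refine h2.congr_deriv ?_
    have h3 : ∑ j, (G s).weight i j • (skewFlow A s (blockEmbedding U i (z s)) -
          skewFlow A s (blockEmbedding U j (z s)))
        = skewFlow A s (∑ j, (G s).weight i j •
          (blockEmbedding U i (z s) - blockEmbedding U j (z s))) := by
      simp only [map_sum, map_smul, map_sub]
    rw [h3, (hU i).starProjection_skewFlow hA, Function.comp_apply, blockEmbedding_system hU,
      map_sub, map_smul, mul_apply_eq_comp, _root_.neg_apply, map_neg]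
    abel

end

/-! ### Windows of joint connectivity -/

/-- Supplies a uniform lower bound for the positive weights of finitely many finite graphs. -/
theorem exists_pos_le_of_pos {α : Type*} [Finite α] (f : α → ℝ) :
    ∃ μ > (0 : ℝ), ∀ a, 0 < f a → μ ≤ f a := by
  have h : ∀ᶠ μ in nhdsWithin (0 : ℝ) (Set.Ioi 0), ∀ a, 0 < f a → μ ≤ f a := by
    refine Filter.eventually_all.2 fun a => ?_
    by_cases ha : 0 < f a
    · filter_upwards [Ioo_mem_nhdsGT ha] with μ hμ _ using hμ.2.le
    · exact Filter.Eventually.of_forall fun _ h => absurd h ha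
  obtain ⟨μ, hμ, hμ0⟩ := (h.and self_mem_nhdsWithin).exists
  exact ⟨μ, hμ0, hμ⟩

/-- A sequence with gaps between `τ > 0` and `T` that starts at `0` meets every `[s, s + T]`. -/
theorem exists_mem_Icc_of_gaps {u : ℕ → ℝ} {τ T : ℝ} (hτ : 0 < τ) (hT : 0 ≤ T) (h0 : u 0 = 0)
    (hlow : ∀ k, τ ≤ u (k + 1) - u k) (hup : ∀ k, u (k + 1) - u k ≤ T) {s : ℝ} (hs : 0 ≤ s) :
    ∃ k, s ≤ u k ∧ u k ≤ s + T := by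
  classical
  have hgrow : ∀ k : ℕ, k * τ ≤ u k := by
    intro k
    induction k with
    | zero => simp [h0]
    | succ k ih =>
      have := hlow k
      push_cast
      linarith
  have hex : ∃ k, s ≤ u k := by
    obtain ⟨k, hk⟩ := exists_nat_ge (s / τ)
    exact ⟨k, ((div_le_iff₀ hτ).1 hk).trans (hgrow k)⟩
  -- The first term that reaches `s` works: its predecessor, if any, lies below `s` and is at most
  -- `T` away.
  refine ⟨Nat.find hex, Nat.find_spec hex, ?_⟩
  rcases hk : Nat.find hex with _ | k
  · rw [h0]
    linarith
  · have h1 : ¬ s ≤ u k := Nat.find_min hex (by omega)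
    have h2 := hup k
    linarith

theorem IsSwitchingSignal.strictMono {P : Type*} {σ : ℝ → P} {t : ℕ → ℝ} {τ : ℝ}
    (hσ : IsSwitchingSignal σ t τ) : StrictMono t :=
  strictMono_nat_of_lt_succ fun j => by linarith [hσ.dwell j, hσ.dwell_pos]

/-- Every edge of the union graph of a window is active, inside this window, on an interval of
length at least the dwell time. -/
theorem IsSwitchingSignal.exists_active_interval {V P : Type*} {G : P → WeightedGraph V}
    {σ : ℝ → P} {t : ℕ → ℝ} {τ : ℝ} (hσ : IsSwitchingSignal σ t τ) {a b : ℕ} {i j : V}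
    (hij : (⨆ (r : ℕ) (_ : t r ∈ Set.Ico (t a) (t b)), (G (σ (t r))).graph).Adj i j) :
    ∃ p q, t a ≤ p ∧ p + τ ≤ q ∧ q ≤ t b ∧ ∀ s ∈ Set.Ico p q, 0 < (G (σ s)).weight i j := by
  simp only [SimpleGraph.iSup_adj] at hij
  obtain ⟨r, hr, hadj⟩ := hij
  have hrb : r < b := hσ.strictMono.lt_iff_lt.1 hr.2
  have hlt : t r < t (r + 1) := hσ.strictMono (Nat.lt_succ_self r)
  refine ⟨t r, t (r + 1), hr.1, by linarith [hσ.dwell r], hσ.strictMono.monotone hrb,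
    fun s hs => ?_⟩
  obtain ⟨p, hp⟩ := hσ.const r
  rw [hp s hs, ← hp (t r) ⟨le_rfl, hlt⟩]
  exact ((G (σ (t r))).weight_pos_iff i j hadj.ne).2 hadj.symm

/-! ### Exponential stability of the switched system. -/

theorem lemma3 {N n n₀ : ℕ} {m ν : Fin N → ℕ}
    (A : Matrix (Fin n) (Fin n) ℝ) (hA : Aᵀ = -A)
    (C : ∀ i, Matrix (Fin (m i)) (Fin n) ℝ)
    (hobs : IsObservable (stackedOutput C) A)
    (G : Fin n₀ → WeightedGraph (Fin N))
    (σ : ℝ → Fin n₀) (t : ℕ → ℝ) (τ : ℝ)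
    (hσ : IsSwitchingSignal σ t τ)
    (hconn : JointlyConnected G σ t τ)
    (U : ∀ i, Matrix (Fin n) (Fin (ν i)) ℝ)
    (hU : ∀ i, IsUnobservableBasis (C i) A (U i))
    (γ : Fin N → ℝ) (hγ : ∀ i, 0 < γ i) :
    ExponentiallyStable fun s =>
      blockA A U - blockGamma ν γ * (blockU U)ᵀ *
        ((G (σ s)).laplacian ⊗ₖ (1 : Matrix (Fin n) (Fin n) ℝ)) * blockU U := by
  obtain ⟨j, T, -, hj0, hT, hwin⟩ := hconn
  obtain ⟨μ, hμ, hμw⟩ := exists_pos_le_of_pos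
    fun e : Fin n₀ × Fin N × Fin N => (G e.1).weight e.2.1 e.2.2
  set W := ∑ e : Fin n₀ × Fin N × Fin N, (G e.1).weight e.2.1 e.2.2
  have hW : ∀ s i k, (G (σ s)).weight i k ≤ W := fun s i k =>
    Finset.single_le_sum (f := fun e : Fin n₀ × Fin N × Fin N => (G e.1).weight e.2.1 e.2.2)
      (fun e _ => (G e.1).weight_nonneg _ _) (Finset.mem_univ (σ s, i, k))
  obtain ⟨c, hc, hloss⟩ := exists_energy_le_mul_energy_loss
    (fun i => LinearMap.range (U i).toEuclideanLin) (iInf_range_eq_bot hobs hU) hγ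
    (W := W) hμ hσ.dwell_pos hT
  have hsymm : ∀ s i k, (G (σ s)).weight i k = (G (σ s)).weight k i := fun s =>
    (G (σ s)).weight_symm
  have hnn : ∀ s i k, 0 ≤ (G (σ s)).weight i k := fun s => (G (σ s)).weight_nonneg
  -- `V a ≤ c * (V a - V b)` means `V b ≤ (1 - c⁻¹) * V a`; `c > 1` makes this factor positive, so
  -- its logarithm can serve as a rate.
  set ρ := 1 - c⁻¹ with hρdef
  have hcinv : c⁻¹ < 1 := inv_lt_one_of_one_lt₀ hc
  have hcinv0 : 0 < c⁻¹ := by positivity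
  have hρ0 : 0 < ρ := by linarith
  have hρ1 : ρ < 1 := by linarith
  have hlog : Real.log ρ < 0 := Real.log_neg hρ0 hρ1
  set g := ∑ i, γ i
  set g' := ∑ i, (γ i)⁻¹
  have hg : ∀ i, γ i ≤ g := fun i =>
    Finset.single_le_sum (fun i _ => (hγ i).le) (Finset.mem_univ i)
  have hg' : ∀ i, (γ i)⁻¹ ≤ g' := fun i =>
    Finset.single_le_sum (fun i _ => (inv_pos.2 (hγ i)).le) (Finset.mem_univ i)
  have hg0 : 0 ≤ g := Finset.sum_nonneg fun i _ => (hγ i).le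
  have hg'0 : 0 ≤ g' := Finset.sum_nonneg fun i _ => (inv_pos.2 (hγ i)).le
  -- The rate of `V` is halved because `V` is comparable to `‖z‖ ^ 2`; the summand 1 makes the
  -- constant visibly positive.
  refine ⟨√(g * ρ⁻¹ * g') + 1, by positivity, -(Real.log ρ / (2 * T)) / 2,
    half_pos (neg_pos.2 (div_neg_of_neg_of_pos hlog (by positivity))), ?_⟩
  intro t₀ ht₀ z hz s hs
  have hflow := hz.isProjectedFlow (G := fun s => G (σ s)) hA hU
  set y : Fin N → ℝ → EuclideanSpace ℝ (Fin n) :=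
    fun i s => skewFlow A s (blockEmbedding U i (z s)) with hy
  set V : ℝ → ℝ := fun s => flowEnergy γ fun i => y i s with hV
  have hanti : AntitoneOn V (Set.Ici t₀) := hflow.antitoneOn_energy hγ hsymm hnn
  have hnorm : ∀ s, ∑ i, ‖y i s‖ ^ 2 = ‖z s‖ ^ 2 := by
    intro s
    simp_rw [hy, norm_skewFlow_apply hA]
    exact sum_norm_blockEmbedding_sq hU (z s)
  have hlow : ∀ s, ‖z s‖ ^ 2 ≤ g * V s := by
    intro s
    simp only [← hnorm, hV, flowEnergy, Finset.mul_sum]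
    refine Finset.sum_le_sum fun i _ => ?_
    rw [← mul_assoc]
    refine le_mul_of_one_le_left (sq_nonneg _) ?_
    rw [← div_eq_mul_inv, one_le_div (hγ i)]
    exact hg i
  have hup : ∀ s, V s ≤ g' * ‖z s‖ ^ 2 := by
    intro s
    simp only [← hnorm, hV, flowEnergy, Finset.mul_sum]
    exact Finset.sum_le_sum fun i _ => mul_le_mul_of_nonneg_right (hg' i) (sq_nonneg _)
  have hV0 : 0 ≤ V t₀ :=
    Finset.sum_nonneg fun i _ => mul_nonneg (inv_pos.2 (hγ i)).le (sq_nonneg _)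
  -- A window starts within time `T` after `s` and lasts at most `T`, so `[s, s + 2 * T]` contains a
  -- whole window.
  have hcontr : ∀ s, t₀ ≤ s → V (s + 2 * T) ≤ ρ * V s := by
    intro s hs
    obtain ⟨k, hk1, hk2⟩ := exists_mem_Icc_of_gaps (u := fun k => t (j k)) hσ.dwell_pos hT.le hj0
      (fun k => (hwin k).1) (fun k => (hwin k).2.1) (ht₀.trans hs)
    obtain ⟨hτk, hTk, hconnk⟩ := hwin k
    have hτ0 := hσ.dwell_pos
    have h1 := hloss _ t₀ y hflow hsymm hnn hW (t (j k)) (t (j (k + 1))) (hs.trans hk1)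
      (by linarith) (by linarith) _ hconnk fun i l hil => by
        obtain ⟨p, q, hp, hpq, hq, hact⟩ := hσ.exists_active_interval hil
        exact ⟨p, q, hp, hpq, hq, fun s hs => hμw (σ s, i, l) (hact s hs)⟩
    change V (t (j k)) ≤ c * (V (t (j k)) - V (t (j (k + 1)))) at h1
    have h2 : V (t (j (k + 1))) ≤ ρ * V (t (j k)) := by
      rw [← inv_mul_le_iff₀ (by linarith)] at h1
      rw [hρdef]
      linarith
    have h3 : V (t (j k)) ≤ V s := hanti hs (hs.trans hk1) hk1
    have h4 : V (s + 2 * T) ≤ V (t (j (k + 1))) :=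
      hanti (Set.mem_Ici.2 (by linarith)) (Set.mem_Ici.2 (by linarith)) (by linarith)
    exact h4.trans (h2.trans (mul_le_mul_of_nonneg_left h3 hρ0.le))
  have hdecay := le_exp_mul_of_antitoneOn_of_contraction (by positivity : 0 < 2 * T) hρ0 hρ1 hV0
    hanti hcontr hs
  set E := Real.exp (-(-(Real.log ρ / (2 * T)) / 2) * (s - t₀)) with hE
  have hEsq : Real.exp (Real.log ρ / (2 * T) * (s - t₀)) = E ^ 2 := by
    rw [hE, ← Real.exp_nat_mul]
    congr 1
    push_cast
    ring
  rw [hEsq] at hdecay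
  have hE0 : 0 ≤ E := (Real.exp_pos _).le
  have hsq : ‖z s‖ ^ 2 ≤ (√(g * ρ⁻¹ * g') * E * ‖z t₀‖) ^ 2 := by
    rw [mul_pow, mul_pow, Real.sq_sqrt (by positivity)]
    calc ‖z s‖ ^ 2 ≤ g * V s := hlow s
      _ ≤ g * (ρ⁻¹ * E ^ 2 * (g' * ‖z t₀‖ ^ 2)) := by
        refine mul_le_mul_of_nonneg_left (hdecay.trans ?_) hg0
        exact mul_le_mul_of_nonneg_left (hup t₀) (by positivity)
      _ = _ := by ring
  refine (pow_le_pow_iff_left₀ (norm_nonneg _) (by positivity) two_ne_zero).1 hsq |>.trans ?_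
  gcongr
  linarith
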